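/- Let $\mathbb M_n$ denote the complex $n\times n$ matrices. Let $A,B\in\mathbb M_n$ be a monotone pair, i.e. there are a positive semidefinite $C\in\mathbb M_n$ and two non-negative, non-decreasing functions $f,g$ on $[0,\infty)$ with $A=f(C)$ and $B=g(C)$. Assume that the pair is concave, i.e. $A=h(B)$ for some concave function $h:[0,\infty)\to[0,\infty)$. Let $\Phi:\mathbb M_n\to\mathbb M_d$ be a positive linear map with $\Phi(I)=I$. Then there are a contraction $K\in\mathbb M_d$ (that is, $\|K\|\le 1$ in the operator norm) and a unitary $U\in\mathbb M_d$ such that $$\Phi(B)\Phi(A)=\sqrt{\Phi(AB)}\,K\,\sqrt{\Phi(AB)}\,U .$$ -/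

import Mathlib

open scoped ComplexOrder MatrixOrder Matrix.Norms.L2Operator

/-- `(A, B)` is a monotone pair in `M_n`: there are a positive (semidefinite) `C` and two
non-negative, non-decreasing functions `f`, `g` on `[0, ∞)` with `A = f(C)` and `B = g(C)`.
No continuity of `f`, `g` is required: the spectrum of a matrix is finite, so every real function
is continuous on it and `cfc f C` is the usual `f(C)` obtained by diagonalization. -/
def IsMonotonePair {n : ℕ} (A B : Matrix (Fin n) (Fin n) ℂ) : Prop :=
  ∃ (C : Matrix (Fin n) (Fin n) ℂ) (f g : ℝ → ℝ),
    C.PosSemidef ∧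
    MonotoneOn f (Set.Ici 0) ∧ (∀ t, 0 ≤ t → 0 ≤ f t) ∧
    MonotoneOn g (Set.Ici 0) ∧ (∀ t, 0 ≤ t → 0 ≤ g t) ∧
    A = cfc f C ∧ B = cfc g C

/-- A monotone pair `(A, B)` is concave if `A = h(B)` for some concave `h : [0, ∞) → [0, ∞)`. -/
def IsConcaveMonotonePair {n : ℕ} (A B : Matrix (Fin n) (Fin n) ℂ) : Prop :=
  IsMonotonePair A B ∧
    ∃ h : ℝ → ℝ, ConcaveOn ℝ (Set.Ici 0) h ∧ (∀ t, 0 ≤ t → 0 ≤ h t) ∧ A = cfc h B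

/-! Diagonalizing `B` and dilating Φ (`exists_isometry_map_cfc`) gives an isometry N with Φ(f(B)) =
N* f(β) N. Put α = h(β) and δ = β/α. By concavity h(t) and t/h(t) are both nondecreasing, so α and δ
increase together. Write a = N*αN = Φ(A), e = N*δN and X = N*α²δN = Φ(AB). Splitting β = (α√δ)·√δ
and taking polar decompositions gives Φ(B) = √X K₁ √e, and √e a = W √(aea), with K₁ and W
contractions. It remains to write √(aea) = L √X U with L a contraction and U unitary, for which
λᵢ(aea) ≤ λᵢ(X) for all i suffices. This is `eigenvalues_compression_le`: if ⟨aea x, x⟩ ≥ μ‖x‖² and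
y = ax, Cauchy–Schwarz gives ‖y‖⁴ ≤ ⟨N*α²N y, y⟩‖x‖², and Chebyshev's inequality for α² and δ then
gives ⟨X y, y⟩ ≥ μ‖y‖². A min-max argument finishes the comparison. -/

set_option linter.unusedSectionVars false

/-! ### Real diagonal matrices, quadratic forms and spectral formulas. -/

namespace Matrix

variable {m n : Type*} [Fintype m] [DecidableEq m] [Fintype n] [DecidableEq n]

/-- The complex diagonal matrix with the given real diagonal. -/
def realDiagonal (f : m → ℝ) : Matrix m m ℂ := diagonal fun k => (f k : ℂ)

lemma realDiagonal_mul (f g : m → ℝ) :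
    realDiagonal f * realDiagonal g = realDiagonal (fun k => f k * g k) := by
  simp [realDiagonal, diagonal_mul_diagonal]

@[simp]
lemma conjTranspose_realDiagonal (f : m → ℝ) : (realDiagonal f)ᴴ = realDiagonal f := by
  simp only [realDiagonal, diagonal_conjTranspose]
  congr 1
  ext k
  simp

lemma realDiagonal_one : realDiagonal (fun _ : m => (1 : ℝ)) = 1 := by
  simp [realDiagonal]

lemma realDiagonal_zero : realDiagonal (fun _ : m => (0 : ℝ)) = 0 := by
  simp [realDiagonal]

lemma norm_realDiagonal_le (f : m → ℝ) (hf : ∀ k, |f k| ≤ 1) : ‖realDiagonal f‖ ≤ 1 := by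
  rw [realDiagonal, l2_opNorm_diagonal]
  refine (pi_norm_le_iff_of_nonneg zero_le_one).2 fun k => ?_
  simpa using hf k

lemma posSemidef_conj_realDiagonal (N : Matrix m n ℂ) {f : m → ℝ} (hf : ∀ k, 0 ≤ f k) :
    (Nᴴ * realDiagonal f * N).PosSemidef := by
  refine PosSemidef.conjTranspose_mul_mul_same ?_ N
  refine PosSemidef.diagonal fun k => ?_
  simpa using hf k

/-- The squared Euclidean norm of a coordinate vector. -/
noncomputable def normSqVec (x : m → ℂ) : ℝ := ∑ k, ‖x k‖ ^ 2

lemma normSqVec_nonneg (x : m → ℂ) : 0 ≤ normSqVec x := by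
  unfold normSqVec; positivity

lemma normSqVec_eq_zero {x : m → ℂ} : normSqVec x = 0 ↔ x = 0 := by
  rw [normSqVec, Finset.sum_eq_zero_iff_of_nonneg (fun _ _ => by positivity)]
  simp [funext_iff]

lemma star_dotProduct_conj_realDiagonal (N : Matrix m n ℂ) (f : m → ℝ) (x : n → ℂ) :
    star x ⬝ᵥ ((Nᴴ * realDiagonal f * N) *ᵥ x) =
      ((∑ k, f k * ‖(N *ᵥ x) k‖ ^ 2 : ℝ) : ℂ) := by
  rw [← mulVec_mulVec, ← mulVec_mulVec, dotProduct_mulVec, ← star_mulVec]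
  simp only [dotProduct, realDiagonal, mulVec_diagonal, Pi.star_apply, Complex.ofReal_sum]
  refine Finset.sum_congr rfl fun k _ => ?_
  rw [mul_left_comm, ← starRingEnd_apply, Complex.conj_mul']
  push_cast
  ring

lemma star_dotProduct_self (x : n → ℂ) : star x ⬝ᵥ x = (normSqVec x : ℂ) := by
  simp only [dotProduct, normSqVec, Pi.star_apply, Complex.ofReal_sum]
  refine Finset.sum_congr rfl fun k _ => ?_
  rw [← starRingEnd_apply, Complex.conj_mul']
  push_cast
  ring

lemma normSqVec_mulVec_of_isometry {N : Matrix m n ℂ} (hN : Nᴴ * N = 1) (x : n → ℂ) :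
    normSqVec (N *ᵥ x) = normSqVec x := by
  have h := star_dotProduct_conj_realDiagonal N (fun _ => 1) x
  rw [realDiagonal_one, Matrix.mul_one, hN, one_mulVec, star_dotProduct_self] at h
  simpa [normSqVec] using (Complex.ofReal_injective h).symm

lemma norm_le_one_of_conjTranspose_mul_self {W : Matrix m n ℂ} (h : ‖Wᴴ * W‖ ≤ 1) : ‖W‖ ≤ 1 := by
  rw [l2_opNorm_conjTranspose_mul_self] at h
  nlinarith [norm_nonneg W]

lemma norm_conj_realDiagonal_le {U : Matrix m m ℂ} (hU : U ∈ unitaryGroup m ℂ) (f : m → ℝ)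
    (hf : ∀ k, |f k| ≤ 1) : ‖U * realDiagonal f * Uᴴ‖ ≤ 1 := by
  have h := CStarRing.norm_mem_unitary_mul (realDiagonal f * Uᴴ) hU
  have h' := CStarRing.norm_mul_mem_unitary (realDiagonal f) (Unitary.star_mem hU)
  rw [star_eq_conjTranspose] at h'
  rw [Matrix.mul_assoc, h, h']
  exact norm_realDiagonal_le f hf

lemma IsHermitian.eq_conj_realDiagonal {P : Matrix m m ℂ} (hP : P.IsHermitian) :
    P = (hP.eigenvectorUnitary : Matrix m m ℂ) * realDiagonal hP.eigenvalues *
      (hP.eigenvectorUnitary : Matrix m m ℂ)ᴴ := by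
  conv_lhs => rw [hP.spectral_theorem, Unitary.conjStarAlgAut_apply]
  rfl

lemma IsHermitian.cfc_eq_conj_realDiagonal {P : Matrix m m ℂ} (hP : P.IsHermitian) (f : ℝ → ℝ) :
    cfc f P = (hP.eigenvectorUnitary : Matrix m m ℂ) *
      realDiagonal (fun k => f (hP.eigenvalues k)) *
      (hP.eigenvectorUnitary : Matrix m m ℂ)ᴴ := by
  rw [hP.cfc_eq, IsHermitian.cfc, Unitary.conjStarAlgAut_apply]
  rfl

lemma conj_unitary_mul {U : Matrix m m ℂ} (hU : U ∈ unitaryGroup m ℂ) (X Y : Matrix m m ℂ) :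
    (U * X * Uᴴ) * (U * Y * Uᴴ) = U * (X * Y) * Uᴴ := by
  have h : Uᴴ * U = 1 := Unitary.star_mul_self_of_mem hU
  calc (U * X * Uᴴ) * (U * Y * Uᴴ) = U * X * (Uᴴ * U) * Y * Uᴴ := by
        simp only [Matrix.mul_assoc]
    _ = _ := by rw [h]; simp only [Matrix.mul_assoc, Matrix.one_mul]

lemma PosSemidef.sqrt_eq_conj_realDiagonal {P : Matrix m m ℂ} (hP : P.PosSemidef) :
    CFC.sqrt P = (hP.1.eigenvectorUnitary : Matrix m m ℂ) *
      realDiagonal (fun k => √(hP.1.eigenvalues k)) *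
      (hP.1.eigenvectorUnitary : Matrix m m ℂ)ᴴ := by
  refine CFC.sqrt_unique ?_ ?_
  · rw [conj_unitary_mul hP.1.eigenvectorUnitary.2, realDiagonal_mul]
    conv_rhs => rw [hP.1.eq_conj_realDiagonal]
    congr 3
    ext k
    exact Real.mul_self_sqrt (hP.eigenvalues_nonneg k)
  · rw [nonneg_iff_posSemidef]
    have := posSemidef_conj_realDiagonal (hP.1.eigenvectorUnitary : Matrix m m ℂ)ᴴ
      (fun k => Real.sqrt_nonneg (hP.1.eigenvalues k))
    rwa [conjTranspose_conjTranspose] at this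

/-! ### Contractive factorizations. -/

/-- Polar decomposition with a contractive left factor. -/
lemma exists_contraction_mul_sqrt (G : Matrix m n ℂ) :
    ∃ W : Matrix m n ℂ, ‖W‖ ≤ 1 ∧ G = W * CFC.sqrt (Gᴴ * G) := by
  have hP := posSemidef_conjTranspose_mul_self G
  set U : Matrix n n ℂ := (hP.1.eigenvectorUnitary : Matrix n n ℂ) with hUdef
  have hU : U ∈ unitaryGroup n ℂ := hP.1.eigenvectorUnitary.2
  have hU1 : Uᴴ * U = 1 := Unitary.star_mul_self_of_mem hU
  have hU2 : U * Uᴴ = 1 := Unitary.mul_star_self_of_mem hU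
  set l := hP.1.eigenvalues with hl
  have hl0 : ∀ k, 0 ≤ l k := hP.eigenvalues_nonneg
  have hspec : Gᴴ * G = U * realDiagonal l * Uᴴ := hP.1.eq_conj_realDiagonal
  have hsq := hP.sqrt_eq_conj_realDiagonal
  rw [← hUdef, ← hl] at hsq
  have hkey : ∀ f : n → ℝ, (G * (U * realDiagonal f))ᴴ * (G * (U * realDiagonal f)) =
      realDiagonal (fun k => f k * l k * f k) := by
    intro f
    calc _ = realDiagonal f * Uᴴ * (Gᴴ * G) * U * realDiagonal f := by
          simp only [conjTranspose_mul, conjTranspose_realDiagonal, Matrix.mul_assoc]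
      _ = realDiagonal f * (Uᴴ * U) * realDiagonal l * (Uᴴ * U) * realDiagonal f := by
          rw [hspec]; simp only [Matrix.mul_assoc]
      _ = _ := by rw [hU1]; simp only [Matrix.mul_one, realDiagonal_mul]
  -- `G` times the pseudo-inverse of √(G*G): the convention 0⁻¹ = 0 kills the kernel.
  refine ⟨G * (U * realDiagonal fun k => (√(l k))⁻¹) * Uᴴ, ?_, ?_⟩
  · apply norm_le_one_of_conjTranspose_mul_self
    rw [conjTranspose_mul, conjTranspose_conjTranspose, Matrix.mul_assoc, ← Matrix.mul_assoc _ᴴ,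
      hkey, ← Matrix.mul_assoc]
    refine norm_conj_realDiagonal_le hU _ fun k => ?_
    rcases (hl0 k).eq_or_lt with h | h
    · simp [← h]
    · have h1 : √(l k) ≠ 0 := (Real.sqrt_pos.2 h).ne'
      have h2 : (√(l k))⁻¹ * l k * (√(l k))⁻¹ = 1 := by
        nth_rewrite 2 [← Real.mul_self_sqrt (hl0 k)]
        field_simp
      rw [h2]; simp
  · rw [hsq]
    -- The part lost to the pseudo-inverse lies in ker G*G = ker G.
    have hz : G * (U * realDiagonal fun k => 1 - (√(l k))⁻¹ * √(l k)) = 0 := by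
      rw [← conjTranspose_mul_self_eq_zero, hkey, ← realDiagonal_zero]
      congr 1
      ext k
      rcases (hl0 k).eq_or_lt with h | h
      · simp [← h]
      · simp [inv_mul_cancel₀ (Real.sqrt_pos.2 h).ne']
    have hadd : (1 : Matrix n n ℂ) = realDiagonal (fun k => (√(l k))⁻¹ * √(l k)) +
        realDiagonal (fun k => 1 - (√(l k))⁻¹ * √(l k)) := by
      rw [← realDiagonal_one]
      simp [realDiagonal]
    calc G = G * (U * 1 * Uᴴ) := by rw [Matrix.mul_one, hU2, Matrix.mul_one]
      _ = G * (U * realDiagonal fun k => (√(l k))⁻¹ * √(l k)) * Uᴴ +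
          G * (U * realDiagonal fun k => 1 - (√(l k))⁻¹ * √(l k)) * Uᴴ := by
        rw [hadd]; simp only [Matrix.mul_add, Matrix.add_mul, Matrix.mul_assoc]
      _ = G * (U * realDiagonal fun k => (√(l k))⁻¹) * (Uᴴ * U) *
          (realDiagonal fun k => √(l k)) * Uᴴ := by
        rw [hz, Matrix.zero_mul, add_zero, hU1, ← realDiagonal_mul]
        simp only [Matrix.mul_assoc, Matrix.one_mul]
      _ = _ := by simp only [Matrix.mul_assoc]

lemma isHermitian_sqrt (P : Matrix m m ℂ) : (CFC.sqrt P)ᴴ = CFC.sqrt P :=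
  (nonneg_iff_posSemidef.1 (CFC.sqrt_nonneg P)).1

/-- Both polar decompositions are taken, and K = V*W collects the two contractive factors. -/
lemma exists_contraction_conjTranspose_mul (G H : Matrix m n ℂ) :
    ∃ K : Matrix n n ℂ, ‖K‖ ≤ 1 ∧ Gᴴ * H = CFC.sqrt (Gᴴ * G) * K * CFC.sqrt (Hᴴ * H) := by
  obtain ⟨V, hV, hG⟩ := exists_contraction_mul_sqrt G
  obtain ⟨W, hW, hH⟩ := exists_contraction_mul_sqrt H
  refine ⟨Vᴴ * W, ?_, ?_⟩
  · refine (l2_opNorm_mul _ _).trans ?_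
    rw [l2_opNorm_conjTranspose]
    exact mul_le_one₀ hV (norm_nonneg _) hW
  · conv_lhs => rw [hG, hH]
    rw [conjTranspose_mul, isHermitian_sqrt]
    simp only [Matrix.mul_assoc]

/-- If the ordered eigenvalues of `P` are dominated by those of `Q`, then `√P` factors through
`√Q` by a contraction and a unitary. -/
lemma exists_contraction_unitary_of_eigenvalues_le {P Q : Matrix m m ℂ} (hP : P.PosSemidef)
    (hQ : Q.PosSemidef) (h : ∀ i, hP.1.eigenvalues i ≤ hQ.1.eigenvalues i) :
    ∃ L U : Matrix m m ℂ, ‖L‖ ≤ 1 ∧ U ∈ unitaryGroup m ℂ ∧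
      CFC.sqrt P = L * CFC.sqrt Q * U := by
  rw [hP.sqrt_eq_conj_realDiagonal, hQ.sqrt_eq_conj_realDiagonal]
  have hV := hP.1.eigenvectorUnitary.2
  have hW := hQ.1.eigenvectorUnitary.2
  set V : Matrix m m ℂ := (hP.1.eigenvectorUnitary : Matrix m m ℂ)
  set W : Matrix m m ℂ := (hQ.1.eigenvectorUnitary : Matrix m m ℂ)
  set p := hP.1.eigenvalues
  set q := hQ.1.eigenvalues
  have hVs : Vᴴ ∈ unitaryGroup m ℂ := Unitary.star_mem hV
  have hWs : Wᴴ ∈ unitaryGroup m ℂ := Unitary.star_mem hW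
  have hW1 : Wᴴ * W = 1 := Unitary.star_mul_self_of_mem hW
  have hV1 : Vᴴ * V = 1 := Unitary.star_mul_self_of_mem hV
  -- Division by zero is harmless: `q k = 0` forces `p k = 0`.
  have hr : ∀ k, √(p k) / √(q k) * √(q k) = √(p k) := by
    intro k
    rcases (Real.sqrt_nonneg (q k)).eq_or_lt with h0 | h0
    · have := Real.sqrt_le_sqrt (h k)
      rw [← h0] at this ⊢
      simp [le_antisymm this (Real.sqrt_nonneg _)]
    · field_simp
  refine ⟨V * realDiagonal (fun k => √(p k) / √(q k)) * Vᴴ * (V * Wᴴ), W * Vᴴ, ?_,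
    mul_mem hW hVs, ?_⟩
  · rw [CStarRing.norm_mul_mem_unitary _ (mul_mem hV hWs)]
    refine norm_conj_realDiagonal_le hV _ fun k => ?_
    rw [abs_of_nonneg (by positivity)]
    exact div_le_one_of_le₀ (Real.sqrt_le_sqrt (h k)) (Real.sqrt_nonneg _)
  · calc _ = V * (realDiagonal (fun k => √(p k) / √(q k)) * realDiagonal fun k => √(q k)) * Vᴴ := by
          rw [realDiagonal_mul]; simp only [hr]
      _ = V * realDiagonal (fun k => √(p k) / √(q k)) * (Vᴴ * V) * (Wᴴ * W) *
          (realDiagonal fun k => √(q k)) * (Wᴴ * W) * Vᴴ := by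
          rw [hV1, hW1]; simp only [Matrix.mul_assoc, Matrix.one_mul]
      _ = _ := by simp only [Matrix.mul_assoc]

/-! ### Min-max comparison of ordered eigenvalues. -/

/-- Comparison of the ordered eigenvalues of two positive semidefinite matrices through a linear
map `L` that is injective where the form of `P` is positive. -/
lemma eigenvalues_le_of_form_le {P Q L : Matrix m m ℂ} (hP : P.PosSemidef) (hQ : Q.PosSemidef)
    (hinj : ∀ μ : ℝ, 0 < μ → ∀ x : m → ℂ, μ * normSqVec x ≤ (star x ⬝ᵥ (P *ᵥ x)).re →
      L *ᵥ x = 0 → x = 0)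
    (hform : ∀ μ : ℝ, 0 < μ → ∀ x : m → ℂ, μ * normSqVec x ≤ (star x ⬝ᵥ (P *ᵥ x)).re →
      μ * normSqVec (L *ᵥ x) ≤ (star (L *ᵥ x) ⬝ᵥ (Q *ᵥ (L *ᵥ x))).re) (i : m) :
    hP.1.eigenvalues i ≤ hQ.1.eigenvalues i := by
  by_contra! hlt
  have hμ : 0 < hP.1.eigenvalues i := (hQ.eigenvalues_nonneg i).trans_lt hlt
  -- The enumeration along which `eigenvalues` is sorted in decreasing order.
  set σ : m ≃ Fin (Fintype.card m) := (Fintype.equivOfCardEq (Fintype.card_fin _)).symm with hσ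
  have hPmono : ∀ k l, σ k ≤ σ l → hP.1.eigenvalues l ≤ hP.1.eigenvalues k :=
    fun k l hkl => hP.1.eigenvalues₀_antitone hkl
  have hQmono : ∀ k l, σ k ≤ σ l → hQ.1.eigenvalues l ≤ hQ.1.eigenvalues k :=
    fun k l hkl => hQ.1.eigenvalues₀_antitone hkl
  have hPs := hP.1.eq_conj_realDiagonal
  have hQs := hQ.1.eq_conj_realDiagonal
  have hV1 : (hP.1.eigenvectorUnitary : Matrix m m ℂ)ᴴ * hP.1.eigenvectorUnitary = 1 :=
    Unitary.star_mul_self_of_mem hP.1.eigenvectorUnitary.2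
  have hW2 : (hQ.1.eigenvectorUnitary : Matrix m m ℂ) * (hQ.1.eigenvectorUnitary : Matrix m m ℂ)ᴴ
      = 1 := Unitary.mul_star_self_of_mem hQ.1.eigenvectorUnitary.2
  set V : Matrix m m ℂ := (hP.1.eigenvectorUnitary : Matrix m m ℂ)
  set W : Matrix m m ℂ := (hQ.1.eigenvectorUnitary : Matrix m m ℂ)
  set p := hP.1.eigenvalues
  set q := hQ.1.eigenvalues
  -- Dimension count: row i is zero, so the system is singular. A kernel vector c yields x = Vc in
  -- the span of the eigenvectors of `P` up to i, with Lx orthogonal to the eigenvectors of `Q`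
  -- before i.
  obtain ⟨c, hc0, hc⟩ : ∃ c ≠ 0, (Matrix.of fun k l => if σ k < σ i then (Wᴴ * (L * V)) k l
      else if σ i < σ k then (1 : Matrix m m ℂ) k l else 0) *ᵥ c = 0 :=
    exists_mulVec_eq_zero_iff.2 (det_eq_zero_of_row_eq_zero i (by simp))
  have hlow : ∀ k, σ k < σ i → (Wᴴ *ᵥ (L *ᵥ (V *ᵥ c))) k = 0 := by
    intro k hk
    have := congrFun hc k
    rw [mulVec_mulVec, mulVec_mulVec, Matrix.mul_assoc]
    simpa [mulVec, dotProduct, hk] using this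
  have hhigh : ∀ k, σ i < σ k → c k = 0 := by
    intro k hk
    have := congrFun hc k
    simpa [mulVec, dotProduct, hk, hk.not_gt, one_apply] using this
  set x := V *ᵥ c with hx
  have hVx : Vᴴ *ᵥ x = c := by rw [hx, mulVec_mulVec, hV1, one_mulVec]
  have hxc : normSqVec x = normSqVec c := normSqVec_mulVec_of_isometry hV1 c
  have hformP : (star x ⬝ᵥ (P *ᵥ x)).re = ∑ k, p k * ‖c k‖ ^ 2 := by
    have := star_dotProduct_conj_realDiagonal Vᴴ p x
    rw [conjTranspose_conjTranspose, ← hPs, hVx] at this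
    rw [this, Complex.ofReal_re]
  have hlower : p i * normSqVec x ≤ (star x ⬝ᵥ (P *ᵥ x)).re := by
    rw [hformP, hxc, normSqVec, Finset.mul_sum]
    refine Finset.sum_le_sum fun k _ => ?_
    rcases le_or_gt (σ k) (σ i) with hk | hk
    · exact mul_le_mul_of_nonneg_right (hPmono k i hk) (by positivity)
    · simp [hhigh k hk]
  set y := L *ᵥ x with hy
  have hyW : normSqVec (Wᴴ *ᵥ y) = normSqVec y :=
    normSqVec_mulVec_of_isometry (by rw [conjTranspose_conjTranspose, hW2]) y
  have hformQ : (star y ⬝ᵥ (Q *ᵥ y)).re = ∑ k, q k * ‖(Wᴴ *ᵥ y) k‖ ^ 2 := by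
    have := star_dotProduct_conj_realDiagonal Wᴴ q y
    rw [conjTranspose_conjTranspose, ← hQs] at this
    rw [this, Complex.ofReal_re]
  have hupper : (star y ⬝ᵥ (Q *ᵥ y)).re ≤ q i * normSqVec y := by
    rw [hformQ, ← hyW, normSqVec, Finset.mul_sum]
    refine Finset.sum_le_sum fun k _ => ?_
    rcases lt_or_ge (σ k) (σ i) with hk | hk
    · simp [hlow k hk]
    · exact mul_le_mul_of_nonneg_right (hQmono i k hk) (by positivity)
  have hle := (hform _ hμ x hlower).trans hupper
  have hy0 : normSqVec y = 0 := by
    by_contra hne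
    have hpos := (normSqVec_nonneg y).lt_of_ne' hne
    exact absurd (le_of_mul_le_mul_right hle hpos) (not_le.2 hlt)
  have hx0 := hinj _ hμ x hlower (normSqVec_eq_zero.1 hy0)
  rw [hx0] at hVx
  exact hc0 (by rw [← hVx, mulVec_zero])

end Matrix

/-! ### Chebyshev's inequality and nonnegative concave functions on the half-line. -/

/-- **Chebyshev's sum inequality** with weights. -/
lemma sum_mul_sum_le_of_monovary {ι : Type*} [Fintype ι] {w f g : ι → ℝ} (hw : ∀ k, 0 ≤ w k)
    (hfg : ∀ k l, 0 ≤ (f k - f l) * (g k - g l)) :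
    (∑ k, f k * w k) * (∑ k, g k * w k) ≤ (∑ k, f k * g k * w k) * ∑ k, w k := by
  have h : 0 ≤ ∑ k, ∑ l, w k * w l * ((f k - f l) * (g k - g l)) :=
    Finset.sum_nonneg fun k _ => Finset.sum_nonneg fun l _ =>
      mul_nonneg (mul_nonneg (hw k) (hw l)) (hfg k l)
  have e : ∑ k, ∑ l, w k * w l * ((f k - f l) * (g k - g l)) =
      2 * ((∑ k, f k * g k * w k) * ∑ k, w k) - 2 * ((∑ k, f k * w k) * ∑ k, g k * w k) := by
    have e1 : ∀ u v : ι → ℝ, (∑ k, u k) * ∑ l, v l = ∑ k, ∑ l, u k * v l :=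
      fun u v => Finset.sum_mul_sum _ _ _ _
    have e2 : ∑ k, ∑ l, w k * w l * ((f k - f l) * (g k - g l)) =
        ((∑ k, f k * g k * w k) * ∑ k, w k + (∑ k, w k) * ∑ k, f k * g k * w k) -
        ((∑ k, f k * w k) * (∑ k, g k * w k) + (∑ k, g k * w k) * ∑ k, f k * w k) := by
      simp only [e1, ← Finset.sum_add_distrib, ← Finset.sum_sub_distrib]
      exact Finset.sum_congr rfl fun k _ => Finset.sum_congr rfl fun l _ => by ring
    rw [e2]; ring
  linarith

namespace ConcaveOn

variable {h : ℝ → ℝ}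

/-- After a decrease, concavity keeps h below a line of negative slope, which eventually makes it
negative. -/
lemma le_of_nonneg_of_le (hc : ConcaveOn ℝ (Set.Ici 0) h) (h0 : ∀ t, 0 ≤ t → 0 ≤ h t)
    {s t : ℝ} (hs : 0 ≤ s) (hst : s ≤ t) : h s ≤ h t := by
  rcases hst.eq_or_lt with rfl | hst
  · rfl
  by_contra! hlt
  set c := (h s - h t) / (t - s) with hcdef
  have hcpos : 0 < c := div_pos (by linarith) (by linarith)
  have ht : 0 ≤ h t := h0 t (by linarith)
  -- The point where the line of slope -c through (t, h t) takes the value -1.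
  set u := t + (h t + 1) / c with hu
  have hgap : 0 < (h t + 1) / c := by positivity
  have hslope := hc.slope_anti_adjacent (x := s) (y := t) (z := u) hs
    (by simp only [Set.mem_Ici]; linarith) hst (by linarith)
  have hneg : (h t - h s) / (t - s) = -c := by rw [hcdef, ← neg_div]; ring
  rw [hneg, div_le_iff₀ (by linarith)] at hslope
  have hval : -c * (u - t) = -(h t + 1) := by rw [hu]; field_simp; ring
  have hu0 := h0 u (by linarith)
  linarith

/-- The graph lies above the chord from 0 to t, and h 0 ≥ 0. This is the division-free form of the
monotonicity of t / h t. -/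
lemma mul_le_mul_of_nonneg (hc : ConcaveOn ℝ (Set.Ici 0) h) (h0 : ∀ t, 0 ≤ t → 0 ≤ h t)
    {s t : ℝ} (hs : 0 ≤ s) (hst : s ≤ t) : s * h t ≤ t * h s := by
  rcases (hs.trans hst).eq_or_lt with ht | ht
  · obtain rfl : s = 0 := le_antisymm (by linarith) hs
    simp [← ht]
  have hconv := hc.2 (Set.mem_Ici.2 ht.le) (Set.mem_Ici.2 le_rfl) (div_nonneg hs ht.le)
    (sub_nonneg.2 (div_le_one_of_le₀ hst ht.le)) (by ring : s / t + (1 - s / t) = 1)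
  have hst' : s / t * t = s := by field_simp
  simp only [smul_eq_mul, mul_zero, add_zero, hst'] at hconv
  have h1 : 0 ≤ (1 - s / t) * h 0 :=
    mul_nonneg (by linarith [div_le_one_of_le₀ hst ht.le]) (h0 0 le_rfl)
  calc s * h t = t * (s / t * h t) := by field_simp
    _ ≤ t * h s := mul_le_mul_of_nonneg_left (by linarith) ht.le

lemma eq_zero_of_nonneg_of_eq_zero (hc : ConcaveOn ℝ (Set.Ici 0) h)
    (h0 : ∀ t, 0 ≤ t → 0 ≤ h t) {s t : ℝ} (hs : 0 < s) (hzero : h s = 0) (ht : 0 ≤ t) :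
    h t = 0 := by
  refine le_antisymm ?_ (h0 t ht)
  rcases le_total t s with hts | hst
  · exact hzero ▸ hc.le_of_nonneg_of_le h0 ht hts
  · have := hc.mul_le_mul_of_nonneg h0 hs.le hst
    rw [hzero, mul_zero] at this
    nlinarith

lemma div_le_div_of_nonneg (hc : ConcaveOn ℝ (Set.Ici 0) h) (h0 : ∀ t, 0 ≤ t → 0 ≤ h t)
    {s t : ℝ} (hs : 0 ≤ s) (hst : s ≤ t) : s / h s ≤ t / h t := by
  have ht := hs.trans hst
  rcases (h0 s hs).eq_or_lt with h1 | h1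
  · rw [← h1, div_zero]
    exact div_nonneg ht (h0 t ht)
  · have h2 := h1.trans_le (hc.le_of_nonneg_of_le h0 hs hst)
    rw [div_le_div_iff₀ h1 h2]
    exact hc.mul_le_mul_of_nonneg h0 hs hst

end ConcaveOn

/-! ### Compressions by an isometry, and the dilation of Φ. -/

namespace Matrix

variable {m n : Type*} [Fintype m] [DecidableEq m] [Fintype n] [DecidableEq n]

/-- A Chebyshev inequality for the eigenvalues of the compressions of a monotone pair of
diagonal matrices. -/
lemma eigenvalues_compression_le {N : Matrix m n ℂ} (hN : Nᴴ * N = 1) {α δ : m → ℝ}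
    (hα : ∀ k, 0 ≤ α k) (hmono : ∀ k l, 0 ≤ (α k - α l) * (δ k - δ l)) {a : Matrix n n ℂ}
    (ha : a = Nᴴ * realDiagonal α * N)
    (hP : (aᴴ * (Nᴴ * realDiagonal δ * N) * a).PosSemidef)
    (hQ : (Nᴴ * realDiagonal (fun k => α k * α k * δ k) * N).PosSemidef) (i : n) :
    hP.1.eigenvalues i ≤ hQ.1.eigenvalues i := by
  have hformP : ∀ x : n → ℂ, (star x ⬝ᵥ ((aᴴ * (Nᴴ * realDiagonal δ * N) * a) *ᵥ x)).re =
      ∑ k, δ k * ‖(N *ᵥ (a *ᵥ x)) k‖ ^ 2 := by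
    intro x
    have h := star_dotProduct_conj_realDiagonal (N * a) δ x
    rw [show (N * a) *ᵥ x = N *ᵥ (a *ᵥ x) from (mulVec_mulVec x N a).symm] at h
    rw [← Complex.ofReal_re (∑ k, δ k * ‖(N *ᵥ (a *ᵥ x)) k‖ ^ 2), ← h]
    simp only [conjTranspose_mul, Matrix.mul_assoc]
  refine eigenvalues_le_of_form_le (L := a) hP hQ ?_ ?_ i
  · intro μ hμ x hx hax
    rw [hformP, hax] at hx
    simp only [mulVec_zero, Pi.zero_apply, norm_zero] at hx
    refine normSqVec_eq_zero.1 (le_antisymm ?_ (normSqVec_nonneg x))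
    have : μ * normSqVec x ≤ 0 := by simpa using hx
    exact nonpos_of_mul_nonpos_right this hμ
  · intro μ hμ x hx
    rw [hformP] at hx
    rw [star_dotProduct_conj_realDiagonal, Complex.ofReal_re]
    set y := a *ᵥ x with hy
    set w : m → ℝ := fun k => ‖(N *ᵥ y) k‖ ^ 2 with hw
    have hwsum : ∑ k, w k = normSqVec y := normSqVec_mulVec_of_isometry hN y
    -- Cauchy–Schwarz applied to ‖y‖² = ⟨y, ax⟩ = ⟨αNy, Nx⟩.
    have hcs : normSqVec y ^ 2 ≤ (∑ k, α k * α k * w k) * normSqVec x := by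
      have h1 : (normSqVec y : ℂ) = ∑ k, star ((N *ᵥ y) k) * ((α k : ℂ) * (N *ᵥ x) k) := by
        rw [← star_dotProduct_self]
        nth_rewrite 2 [hy]
        rw [ha, ← mulVec_mulVec, ← mulVec_mulVec, dotProduct_mulVec, ← star_mulVec]
        simp only [dotProduct, realDiagonal, mulVec_diagonal, Pi.star_apply]
      have h2 : normSqVec y ≤ ∑ k, (α k * ‖(N *ᵥ y) k‖) * ‖(N *ᵥ x) k‖ := by
        have h3 := norm_sum_le Finset.univ
          fun k => star ((N *ᵥ y) k) * ((α k : ℂ) * (N *ᵥ x) k)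
        rw [← h1, Complex.norm_real, Real.norm_of_nonneg (normSqVec_nonneg y)] at h3
        refine h3.trans_eq (Finset.sum_congr rfl fun k _ => ?_)
        rw [norm_mul, norm_mul, norm_star, Complex.norm_real, Real.norm_of_nonneg (hα k)]
        ring
      calc normSqVec y ^ 2 ≤ (∑ k, (α k * ‖(N *ᵥ y) k‖) * ‖(N *ᵥ x) k‖) ^ 2 :=
            pow_le_pow_left₀ (normSqVec_nonneg y) h2 2
        _ ≤ (∑ k, (α k * ‖(N *ᵥ y) k‖) ^ 2) * ∑ k, ‖(N *ᵥ x) k‖ ^ 2 :=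
            Finset.sum_mul_sq_le_sq_mul_sq _ _ _
        _ = _ := by
            rw [← normSqVec_mulVec_of_isometry hN x, normSqVec]
            congr 1
            exact Finset.sum_congr rfl fun k _ => by rw [hw]; ring
    have hcheb := sum_mul_sum_le_of_monovary (w := w) (f := fun k => α k * α k) (g := δ)
      (fun k => by positivity) fun k l => by
        have : (α k * α k - α l * α l) * (δ k - δ l) =
          (α k + α l) * ((α k - α l) * (δ k - δ l)) := by ring
        rw [this]
        exact mul_nonneg (add_nonneg (hα k) (hα l)) (hmono k l)
    rw [hwsum] at hcheb
    have hS : 0 ≤ ∑ k, α k * α k * w k :=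
      Finset.sum_nonneg fun k _ => mul_nonneg (mul_self_nonneg _) (by positivity)
    rcases (normSqVec_nonneg y).eq_or_lt with h0 | h0
    · rw [← h0, mul_zero]
      have hyz : y = 0 := normSqVec_eq_zero.1 h0.symm
      simp [hyz]
    · refine le_of_mul_le_mul_right ?_ h0
      calc μ * normSqVec y * normSqVec y = μ * normSqVec y ^ 2 := by ring
        _ ≤ μ * ((∑ k, α k * α k * w k) * normSqVec x) := mul_le_mul_of_nonneg_left hcs hμ.le
        _ = (∑ k, α k * α k * w k) * (μ * normSqVec x) := by ring
        _ ≤ (∑ k, α k * α k * w k) * ∑ k, δ k * w k := mul_le_mul_of_nonneg_left hx hS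
        _ ≤ _ := hcheb

/-- The factorization for the compressions of commuting diagonal matrices `α` and `β = δ α`, where
`α` and `δ` are monotone in each other. -/
lemma exists_factorization_compression {N : Matrix m n ℂ} (hN : Nᴴ * N = 1) {α β δ : m → ℝ}
    (hα : ∀ k, 0 ≤ α k) (hδ : ∀ k, 0 ≤ δ k) (hβ : ∀ k, β k = α k * δ k)
    (hmono : ∀ k l, 0 ≤ (α k - α l) * (δ k - δ l)) :
    ∃ K U : Matrix n n ℂ, ‖K‖ ≤ 1 ∧ U ∈ unitaryGroup n ℂ ∧
      (Nᴴ * realDiagonal β * N) * (Nᴴ * realDiagonal α * N) =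
        CFC.sqrt (Nᴴ * realDiagonal (fun k => α k * β k) * N) * K *
          CFC.sqrt (Nᴴ * realDiagonal (fun k => α k * β k) * N) * U := by
  have hgram : ∀ f g : m → ℝ, (realDiagonal f * N)ᴴ * (realDiagonal g * N) =
      Nᴴ * realDiagonal (fun k => f k * g k) * N := by
    intro f g
    rw [← realDiagonal_mul, conjTranspose_mul, conjTranspose_realDiagonal]
    simp only [Matrix.mul_assoc]
  set a := Nᴴ * realDiagonal α * N with ha
  set e := Nᴴ * realDiagonal δ * N with he
  have hX : (fun k => α k * β k) = fun k => α k * α k * δ k := by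
    ext k; rw [hβ]; ring
  rw [hX]
  have hQ : (Nᴴ * realDiagonal (fun k => α k * α k * δ k) * N).PosSemidef :=
    posSemidef_conj_realDiagonal N fun k => mul_nonneg (mul_self_nonneg _) (hδ k)
  have he0 : e.PosSemidef := posSemidef_conj_realDiagonal N hδ
  have hP : (aᴴ * e * a).PosSemidef := he0.conjTranspose_mul_mul_same a
  -- The Gram matrices of these two factors are N*α²δN and e, and their mixed product is N*βN.
  obtain ⟨K₁, hK₁, hb⟩ := exists_contraction_conjTranspose_mul
    (realDiagonal (fun k => α k * √(δ k)) * N) (realDiagonal (fun k => √(δ k)) * N)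
  have e1 : (fun k => α k * √(δ k) * (α k * √(δ k))) = fun k => α k * α k * δ k := by
    ext k
    rw [mul_mul_mul_comm, Real.mul_self_sqrt (hδ k)]
  have e2 : (fun k => α k * √(δ k) * √(δ k)) = β := by
    ext k
    rw [mul_assoc, Real.mul_self_sqrt (hδ k), hβ]
  have e3 : (fun k => √(δ k) * √(δ k)) = δ := by
    ext k
    exact Real.mul_self_sqrt (hδ k)
  rw [hgram, hgram, hgram, e1, e2, e3, ← he] at hb
  obtain ⟨W, hW, hT⟩ := exists_contraction_mul_sqrt (CFC.sqrt e * a)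
  have hTT : (CFC.sqrt e * a)ᴴ * (CFC.sqrt e * a) = aᴴ * e * a := by
    rw [conjTranspose_mul, isHermitian_sqrt, Matrix.mul_assoc, ← Matrix.mul_assoc (CFC.sqrt e),
      CFC.sqrt_mul_sqrt_self e (nonneg_iff_posSemidef.2 he0), ← Matrix.mul_assoc]
  rw [hTT] at hT
  obtain ⟨L, U, hL, hU, hLU⟩ := exists_contraction_unitary_of_eigenvalues_le hP hQ
    (eigenvalues_compression_le hN hα hmono ha hP hQ)
  refine ⟨K₁ * W * L, U, ?_, hU, ?_⟩
  · refine (l2_opNorm_mul _ _).trans (mul_le_one₀ ((l2_opNorm_mul _ _).trans ?_) (norm_nonneg _) hL)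
    exact mul_le_one₀ hK₁ (norm_nonneg _) hW
  · rw [hb, Matrix.mul_assoc _ (CFC.sqrt e) a, hT, hLU]
    simp only [Matrix.mul_assoc]

/-- Naimark dilation of a unital positive map restricted to the functions of a Hermitian
matrix. -/
lemma exists_isometry_map_cfc {n d : ℕ} {B : Matrix (Fin n) (Fin n) ℂ} (hB : B.IsHermitian)
    (Φ : Matrix (Fin n) (Fin n) ℂ →ₚ[ℂ] Matrix (Fin d) (Fin d) ℂ) (hΦ : Φ 1 = 1) :
    ∃ N : Matrix (Fin n × Fin d) (Fin d) ℂ, Nᴴ * N = 1 ∧ ∀ f : ℝ → ℝ,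
      Φ (cfc f B) =
        Nᴴ * realDiagonal (fun k : Fin n × Fin d => f (hB.eigenvalues k.1)) * N := by
  set V : Matrix (Fin n) (Fin n) ℂ := (hB.eigenvectorUnitary : Matrix (Fin n) (Fin n) ℂ) with hV
  have hV2 : V * Vᴴ = 1 := Unitary.mul_star_self_of_mem hB.eigenvectorUnitary.2
  have hpos : ∀ i, (Φ (V * diagonal (Pi.single i 1) * Vᴴ)).PosSemidef := by
    intro i
    refine nonneg_iff_posSemidef.1 (Φ.map_nonneg (nonneg_iff_posSemidef.2 ?_))
    refine PosSemidef.mul_mul_conjTranspose_same (PosSemidef.diagonal fun k => ?_) V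
    rw [Pi.single_apply]
    split_ifs <;> simp
  have hfact : ∀ i, ∃ R : Matrix (Fin d) (Fin d) ℂ,
      Φ (V * diagonal (Pi.single i 1) * Vᴴ) = Rᴴ * R := fun i =>
    CStarAlgebra.nonneg_iff_eq_star_mul_self.1 (nonneg_iff_posSemidef.2 (hpos i))
  choose R hR using hfact
  -- The blocks Rᵢ are stacked in a column, so N*N = ∑ Rᵢ*Rᵢ is the image under Φ of the sum of the
  -- rank-one spectral projections, which is Φ(1).
  set N : Matrix (Fin n × Fin d) (Fin d) ℂ := Matrix.of fun k l => R k.1 k.2 l with hNdef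
  have hmap : ∀ f : Fin n → ℝ, Φ (V * realDiagonal f * Vᴴ) =
      Nᴴ * realDiagonal (fun k : Fin n × Fin d => f k.1) * N := by
    intro f
    have hsum : V * realDiagonal f * Vᴴ =
        ∑ i, (f i : ℂ) • (V * diagonal (Pi.single i 1) * Vᴴ) := by
      have hd : realDiagonal f = ∑ i, (f i : ℂ) • diagonal (Pi.single i (1 : ℂ)) := by
        ext k l
        rw [Matrix.sum_apply]
        by_cases hkl : k = l
        · subst hkl
          simp [realDiagonal, Pi.single_apply]
        · simp [realDiagonal, hkl]
      rw [hd, Finset.mul_sum, Finset.sum_mul]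
      simp
    rw [hsum, map_sum]
    simp only [map_smul, hR]
    ext k l
    rw [Matrix.sum_apply, Matrix.mul_apply, Fintype.sum_prod_type]
    refine Finset.sum_congr rfl fun i _ => ?_
    simp only [realDiagonal, mul_diagonal]
    simp only [smul_apply, Matrix.mul_apply, smul_eq_mul, Finset.mul_sum, hNdef,
      conjTranspose_apply, of_apply]
    exact Finset.sum_congr rfl fun j _ => by ring
  refine ⟨N, ?_, fun f => ?_⟩
  · have := hmap fun _ => 1
    rw [realDiagonal_one, realDiagonal_one, Matrix.mul_one, Matrix.mul_one, hV2, hΦ] at this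
    exact this.symm
  · rw [hB.cfc_eq_conj_realDiagonal, hmap]

end Matrix

/-- Here `≤` on matrices is the Loewner order, `→ₚ[ℂ]` is a positive complex-linear map, `‖K‖` is
the operator norm for the Euclidean norm on `ℂ^d`, and `CFC.sqrt` is the positive square root. -/
theorem theorem2p3 {n d : ℕ} (A B : Matrix (Fin n) (Fin n) ℂ) (hAB : IsConcaveMonotonePair A B)
    (Φ : Matrix (Fin n) (Fin n) ℂ →ₚ[ℂ] Matrix (Fin d) (Fin d) ℂ) (hΦ : Φ 1 = 1) :
    ∃ K U : Matrix (Fin d) (Fin d) ℂ, ‖K‖ ≤ 1 ∧ U ∈ Matrix.unitaryGroup (Fin d) ℂ ∧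
      Φ B * Φ A = CFC.sqrt (Φ (A * B)) * K * CFC.sqrt (Φ (A * B)) * U := by
  obtain ⟨⟨C, f, g, hC, -, -, -, hg0, -, hBC⟩, h, hc, h0, rfl⟩ := hAB
  have hB : B.PosSemidef := by
    rw [hBC, hC.1.cfc_eq_conj_realDiagonal]
    have := Matrix.posSemidef_conj_realDiagonal
      (hC.1.eigenvectorUnitary : Matrix (Fin n) (Fin n) ℂ).conjTranspose
      (fun k => hg0 _ (hC.eigenvalues_nonneg k))
    rwa [Matrix.conjTranspose_conjTranspose] at this
  obtain ⟨N, hN, hmap⟩ := Matrix.exists_isometry_map_cfc hB.1 Φ hΦ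
  have hfin : ∀ f : ℝ → ℝ, ContinuousOn f (spectrum ℝ B) := fun f =>
    (Matrix.finite_real_spectrum (A := B)).continuousOn f
  have hid : cfc (fun t : ℝ => t) B = B := cfc_id' ℝ B hB.1
  have hprod : cfc h B * B = cfc (fun t => h t * t) B := by
    conv_lhs => rw [← hid]
    rw [hid, cfc_mul h (fun t => t) B (hfin _) (hfin _), hid]
  set β := hB.1.eigenvalues
  have hβ0 : ∀ k, 0 ≤ β k := hB.eigenvalues_nonneg
  -- A zero of h at a positive eigenvalue forces A = 0. Otherwise β = αδ holds with δ = β / h(β),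
  -- including at β = 0, where δ = 0.
  by_cases hz : ∃ k, 0 < β k ∧ h (β k) = 0
  · obtain ⟨k, hk, hhk⟩ := hz
    have hA : cfc h B = 0 := by
      rw [hB.1.cfc_eq_conj_realDiagonal]
      simp only [hc.eq_zero_of_nonneg_of_eq_zero h0 hk hhk (hβ0 _), Matrix.realDiagonal_zero,
        Matrix.mul_zero, Matrix.zero_mul, β]
    exact ⟨0, 1, by simp, one_mem _, by simp [hA]⟩
  · push Not at hz
    have hΦB := hmap fun t => t
    rw [hid] at hΦB
    rw [hprod, hmap, hmap, hΦB]
    refine Matrix.exists_factorization_compression hN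
      (α := fun k : Fin n × Fin d => h (β k.1)) (β := fun k : Fin n × Fin d => β k.1)
      (δ := fun k : Fin n × Fin d => β k.1 / h (β k.1))
      (fun k => h0 _ (hβ0 _)) (fun k => div_nonneg (hβ0 _) (h0 _ (hβ0 _))) (fun k => ?_)
      fun k l => ?_
    · rcases (hβ0 k.1).eq_or_lt with hk | hk
      · simp [← hk]
      · have := hz _ hk
        field_simp
    · rcases le_total (β k.1) (β l.1) with hkl | hkl
      · exact mul_nonneg_of_nonpos_of_nonpos
          (sub_nonpos.2 (hc.le_of_nonneg_of_le h0 (hβ0 _) hkl))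
          (sub_nonpos.2 (hc.div_le_div_of_nonneg h0 (hβ0 _) hkl))
      · exact mul_nonneg (sub_nonneg.2 (hc.le_of_nonneg_of_le h0 (hβ0 _) hkl))
          (sub_nonneg.2 (hc.div_le_div_of_nonneg h0 (hβ0 _) hkl))
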